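/- Let $d\ge 1$, let $\|\cdot\|$ be the Euclidean norm on $\mathbb{R}^d$, and write $d(x,A)=\inf_{y\in A}\|x-y\|$, $\partial A$ for the topological boundary of $A$, $B(A,r)=\{x:d(x,A)\le r\}$, $\omega_d$ for the Lebesgue measure of the unit ball, and $d_H$ for the Hausdorff distance. The reach of a closed set $A\subset\mathbb{R}^d$ is $\mathrm{reach}(A)=\inf_{x\in A}\,\sup\{r>0:\text{ every point of the open ball of centre }x\text{ and radius }r\text{ has a unique nearest point in }A\}\in[0,\infty]$. Let $\mathcal{M}\subset\mathbb{R}^d$ be a compact set with empty interior, let $0<R_1<\mathrm{reach}(\mathcal{M})$, and put $S=B(\mathcal{M},R_1)$. Let $Y_1,Y_2,\dots$ be iid random points of $\mathbb{R}^d$ whose distribution has support $S$ and is absolutely continuous with respect to Lebesgue measure, with a density that is bounded from below on $S$ by a constant $f_0>0$; let $\mathcal{Y}_n=\{Y_1,\dots,Y_n\}$. Let $\hat S_n\subset\mathbb{R}^d$ and $\hat R_n\in\mathbb{R}$ be estimators, based on $Y_1,\dots,Y_n$, and let $a_n\to0$ and $e_n\to0$ be sequences of real numbers such that, with probability one, $d_H(\partial\hat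 S_n,\partial S)<a_n$ and $|\hat R_n-R_1|\le e_n$ for all $n$ large enough. Fix $\lambda\in(0,1)$. The denoised sample is defined as follows. Let $Y^\lambda_1,\dots,Y^\lambda_m$ be those points $Y_i\in\mathcal{Y}_n$ for which $d(Y_i,\partial\hat S_n)>\lambda\hat R_n$, and let $\mathcal{Z}_m=\{Z_1,\dots,Z_m\}$ with $$Z_i=\pi_{\partial\hat S_n}(Y^\lambda_i)+\hat R_n\,\frac{Y^\lambda_i-\pi_{\partial\hat S_n}(Y^\lambda_i)}{\|Y^\lambda_i-\pi_{\partial\hat S_n}(Y^\lambda_i)\|},$$ where $\pi_{\partial\hat S_n}(y)$ is a point of $\partial\hat S_n$ nearest to $y$ (any choice of it). Let $\varepsilon_n=c(\log(n)/n)^{1/d}$ with $c>(6/(f_0\omega_d))^{1/d}$. Then there is a (deterministic) sequence $b_n=\mathcal{O}\left(\max(a_n^{1/3},e_n,\varepsilon_n)\right)$ such that, with probability one, for all $n$ large enough, $$d_H(\mathcal{Z}_m,\mathcal{M})\le b_n .$$ -/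

import Mathlib

open MeasureTheory ProbabilityTheory Filter Topology
open scoped ENNReal NNReal

noncomputable section

namespace Denoising

/-- `p` is a metric projection of `x` on `A`: a point of `A` at minimal distance from `x`. -/
def IsMetricProjection {E : Type*} [PseudoMetricSpace E] (A : Set E) (x p : E) : Prop :=
  p ∈ A ∧ dist x p = Metric.infDist x A

/-- The set of points with a unique metric projection on `A`. -/
def unp {E : Type*} [PseudoMetricSpace E] (A : Set E) : Set E :=
  {x | ∃! p, IsMetricProjection A x p}

/-- The reach of `A` at `x`: the supremum of the radii `r > 0` for which the open ball of centre
`x` and radius `r` is contained in `unp A`. -/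
def reachAt {E : Type*} [PseudoMetricSpace E] (A : Set E) (x : E) : ℝ≥0∞ :=
  sSup {s | ∃ r : ℝ, 0 < r ∧ Metric.ball x r ⊆ unp A ∧ s = ENNReal.ofReal r}

/-- The reach of `A`; it is `∞` for instance when `A` is closed, convex and nonempty. -/
def reach {E : Type*} [PseudoMetricSpace E] (A : Set E) : ℝ≥0∞ :=
  ⨅ x ∈ A, reachAt A x

/-- The denoised sample obtained from the points `y i`, with `A` the estimated boundary, `R` the
estimated noise level, `lam` the selection parameter, and `p` a choice of metric projections
on `A`: each `y i` with `d(y i, A) > lam * R` is moved to the point at (signed) distance `R` from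
`p (y i)` in the direction from `p (y i)` to `y i`; the other points are discarded. -/
def denoisedSample {E : Type*} [NormedAddCommGroup E] [NormedSpace ℝ E] {n : ℕ}
    (A : Set E) (R lam : ℝ) (p : E → E) (y : Fin n → E) : Set E :=
  {z | ∃ i, lam * R < Metric.infDist (y i) A ∧
    z = p (y i) + (R / ‖y i - p (y i)‖) • (y i - p (y i))}

end Denoising

end

/-! Below the reach the distance to `M` increases at unit speed, so `d(y, ∂S) = R₁ - d(y, M)` for
`y` in `S`. Let `m` and `p` be nearest points of `y` on `M` and on the estimated boundary. Then `‖y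
- p‖ + ‖y - m‖ ≤ R₁ + a`, while `‖m - p‖ ≥ R₁ - a`: the triangle inequality is nearly an equality,
so `y` lies near the segment from `p` to `m`. Selection keeps `‖y - p‖` away from `0`, so the
denoised point is within `C√a + e` of `m` (`exists_dist_denoised_le`). Conversely, by Borel–Cantelli
every point of `M` has a sample point within order `(log n / n)^(1/d)`
(`ae_eventually_forall_exists_dist_lt`). Such a point is deep inside `S`, hence selected because
`lam < 1`. This gives the rate `√a`, and `√a ≤ a^(1/3)` once `a ≤ 1`. -/

namespace Denoising

/-! ### Distance to a set below its reach -/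

open Metric in
/-- At a point with a unique projection outside `M`, the distance to `M` has slope one. -/
lemma exists_lt_infDist_add_smul {E : Type*} [NormedAddCommGroup E] [InnerProductSpace ℝ E]
    {M : Set E} (hM : IsCompact M) {z : E} (hz : z ∈ unp M)
    (hpos : 0 < infDist z M) {κ ρ : ℝ} (hκ : κ < 1) (hρ : 0 < ρ) :
    ∃ v : E, ∃ ε : ℝ, ‖v‖ = 1 ∧ 0 < ε ∧ ε < ρ ∧
      infDist z M + κ * ε < infDist (z + ε • v) M := by
  obtain ⟨q, ⟨hqM, hq⟩, huniq⟩ := hz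
  have hne : M.Nonempty := ⟨q, hqM⟩
  have hzq : ‖z - q‖ = infDist z M := by rw [← hq, dist_eq_norm]
  set s := infDist z M with hs
  set v : E := s⁻¹ • (z - q) with hv
  have hv1 : ‖v‖ = 1 := by
    rw [hv, norm_smul, hzq, Real.norm_eq_abs, abs_of_pos (inv_pos.2 hpos),
      inv_mul_cancel₀ hpos.ne']
  have hvq : inner ℝ (z - q) v = s := by
    rw [hv, inner_smul_right, real_inner_self_eq_norm_sq, hzq]
    field_simp
  -- Otherwise the distance grows with slope at most `κ` along `v`. Nearest points of `z + t • v`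
  -- tend to `q` by uniqueness, and expanding squares gives `s ≤ κ * s` in the limit.
  by_contra! hcon
  have hε : ∀ n : ℕ, 0 < ρ / (n + 2 : ℝ) ∧ ρ / (n + 2 : ℝ) < ρ := by
    intro n
    refine ⟨by positivity, div_lt_self hρ (by linarith [(n.cast_nonneg : (0:ℝ) ≤ n)])⟩
  have hlim : Tendsto (fun n : ℕ => ρ / (n + 2 : ℝ)) atTop (𝓝 0) :=
    Tendsto.div_atTop tendsto_const_nhds
      (tendsto_atTop_add_const_right _ _ tendsto_natCast_atTop_atTop)
  choose w hwM hw using fun n : ℕ => hM.exists_infDist_eq_dist hne (z + (ρ / (n + 2 : ℝ)) • v)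
  obtain ⟨w₀, hw₀M, φ, hφ, hφlim⟩ := hM.tendsto_subseq hwM
  have hlimφ : Tendsto (fun n => ρ / ((φ n : ℕ) + 2 : ℝ)) atTop (𝓝 0) :=
    hlim.comp hφ.tendsto_atTop
  have hptlim : Tendsto (fun n => z + (ρ / ((φ n : ℕ) + 2 : ℝ)) • v) atTop (𝓝 z) := by
    simpa using (tendsto_const_nhds (x := z)).add (hlimφ.smul_const v)
  have hw₀ : w₀ = q := by
    refine huniq w₀ ⟨hw₀M, ?_⟩
    have h1 := hptlim.dist hφlim
    have h2 : Tendsto (fun n => infDist (z + (ρ / ((φ n : ℕ) + 2 : ℝ)) • v) M) atTop (𝓝 s) :=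
      ((continuous_infDist_pt M).tendsto z).comp hptlim
    refine tendsto_nhds_unique h1 (h2.congr fun n => hw (φ n))
  subst hw₀
  have key : ∀ n : ℕ, inner ℝ (z - w n) v ≤ κ * s + (κ ^ 2 / 2) * (ρ / (n + 2 : ℝ)) := by
    intro n
    obtain ⟨h0, h1⟩ := hε n
    have h2 := hcon v _ hv1 h0 h1
    set t := ρ / (n + 2 : ℝ)
    have h3 : (infDist (z + t • v) M) ^ 2 = ‖z - w n‖ ^ 2 + 2 * t * inner ℝ (z - w n) v + t ^ 2 := by
      rw [hw n, dist_eq_norm, show z + t • v - w n = (z - w n) + t • v by abel,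
        norm_add_sq_real, inner_smul_right, norm_smul, hv1, mul_one, Real.norm_eq_abs, sq_abs]
      ring
    have h4 : s ≤ ‖z - w n‖ := by
      rw [hs, ← dist_eq_norm]; exact infDist_le_dist_of_mem (hwM n)
    have h5 : (infDist (z + t • v) M) ^ 2 ≤ (s + κ * t) ^ 2 :=
      pow_le_pow_left₀ infDist_nonneg h2 2
    have h6 : s ^ 2 ≤ ‖z - w n‖ ^ 2 := pow_le_pow_left₀ hpos.le h4 2
    have h7 : t * (2 * inner ℝ (z - w n) v) ≤ t * (2 * (κ * s + (κ ^ 2 / 2) * t)) := by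
      nlinarith [sq_nonneg t]
    have := le_of_mul_le_mul_left h7 h0
    linarith
  have hl : Tendsto (fun n => inner ℝ (z - w (φ n)) v) atTop (𝓝 (inner ℝ (z - w₀) v)) :=
    (tendsto_const_nhds.sub hφlim).inner tendsto_const_nhds
  have hr : Tendsto (fun n => κ * s + (κ ^ 2 / 2) * (ρ / ((φ n : ℕ) + 2 : ℝ))) atTop
      (𝓝 (κ * s)) := by
    simpa using (tendsto_const_nhds (x := κ * s)).add (hlimφ.const_mul (κ ^ 2 / 2))
  have := le_of_tendsto_of_tendsto' hl hr fun n => key (φ n)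
  rw [hvq] at this
  nlinarith

open Metric in
/-- On a closed ball contained in `unp M`, the distance to `M` grows by the full radius. -/
lemma exists_infDist_eq_add {E : Type*} [NormedAddCommGroup E] [InnerProductSpace ℝ E] [ProperSpace E]
    {M : Set E} (hM : IsCompact M) {x : E} (hpos : 0 < infDist x M)
    {h : ℝ} (hh : 0 ≤ h) (hball : closedBall x h ⊆ unp M) :
    ∃ y, dist y x ≤ h ∧ infDist x M + h ≤ infDist y M := by
  obtain ⟨y, hy, hymax⟩ := (isCompact_closedBall x h).exists_isMaxOn
    ⟨x, mem_closedBall_self hh⟩ (continuous_infDist_pt M).continuousOn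
  refine ⟨y, hy, ?_⟩
  rcases hh.eq_or_lt with rfl | hh0
  · simpa using hymax (mem_closedBall_self le_rfl)
  -- Penalise the distance by `κ * dist z x`: a maximiser inside the ball would contradict the slope
  -- lemma, so it lies on the sphere of radius `h`. Then `κ` tends to `1`.
  have key : ∀ κ : ℝ, 0 < κ → κ < 1 → infDist x M + κ * h ≤ infDist y M := by
    intro κ hκ0 hκ
    obtain ⟨z, hz, hzmax⟩ := (isCompact_closedBall x h).exists_isMaxOn
      ⟨x, mem_closedBall_self hh⟩
      (f := fun z => infDist z M - κ * dist z x)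
      ((continuous_infDist_pt M).sub (continuous_const.mul
        (continuous_id.dist continuous_const))).continuousOn
    have hx := hzmax (mem_closedBall_self hh)
    simp only [dist_self, mul_zero, sub_zero, Set.mem_ofPred_eq] at hx
    rcases (mem_closedBall.1 hz).lt_or_eq with hlt | heq
    · exfalso
      have hzpos : 0 < infDist z M := by nlinarith [dist_nonneg (x := z) (y := x)]
      obtain ⟨v, ε, hv, hε, hερ, hgt⟩ :=
        exists_lt_infDist_add_smul hM (hball hz) hzpos hκ (sub_pos.2 hlt)
      have hd : dist (z + ε • v) x ≤ dist z x + ε := by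
        have := dist_triangle (z + ε • v) z x
        rw [dist_self_add_left, norm_smul, hv, Real.norm_eq_abs, abs_of_pos hε] at this
        linarith
      have := hzmax (show z + ε • v ∈ closedBall x h from mem_closedBall.2 (by linarith))
      simp only [Set.mem_ofPred_eq] at this
      nlinarith
    · have := hymax hz
      simp only [Set.mem_ofPred_eq] at this
      rw [heq] at hx
      linarith
  have hlim : Tendsto (fun κ : ℝ => infDist x M + κ * h) (𝓝[<] 1) (𝓝 (infDist x M + 1 * h)) :=
    ((continuous_const.add (continuous_id.mul continuous_const)).tendsto 1).mono_left
      nhdsWithin_le_nhds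
  rw [one_mul] at hlim
  refine le_of_tendsto hlim ?_
  filter_upwards [Ioo_mem_nhdsLT (show (0:ℝ) < 1 by norm_num)] with κ hκ
  exact key κ hκ.1 hκ.2

-- The reach at a nearest point `q` of `x` provides a ball around `q` that contains `x`.
open Metric in
lemma mem_unp_of_infDist_lt_reach {E : Type*} [PseudoMetricSpace E]
    {M : Set E} (hM : IsCompact M) (hne : M.Nonempty) {x : E}
    (hx : ENNReal.ofReal (infDist x M) < reach M) : x ∈ unp M := by
  obtain ⟨q, hqM, hq⟩ := hM.exists_infDist_eq_dist hne x
  have h1 : ENNReal.ofReal (infDist x M) < reachAt M q := hx.trans_le (iInf₂_le q hqM)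
  obtain ⟨_, ⟨r, hr, hball, rfl⟩, hlt⟩ := lt_sSup_iff.1 h1
  refine hball ?_
  rw [mem_ball, ← hq]
  exact (ENNReal.ofReal_lt_ofReal_iff hr).1 hlt

open Metric in
/-- Below the reach, the distance to `M` can be increased at unit speed away from any point. -/
lemma exists_dist_le_infDist_eq {E : Type*} [NormedAddCommGroup E] [InnerProductSpace ℝ E] [ProperSpace E]
    {M : Set E} (hM : IsCompact M) {x : E} {t : ℝ}
    (hpos : 0 < infDist x M) (hxt : infDist x M ≤ t) (ht : ENNReal.ofReal t < reach M) :
    ∃ y, dist x y ≤ t - infDist x M ∧ infDist y M = t := by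
  have hne : M.Nonempty := by
    by_contra h
    rw [Set.not_nonempty_iff_eq_empty.1 h, infDist_empty] at hpos
    exact hpos.false
  obtain ⟨y, hyx, hy⟩ := exists_infDist_eq_add hM hpos (sub_nonneg.2 hxt) (by
    intro z hz
    refine mem_unp_of_infDist_lt_reach hM hne (lt_of_le_of_lt ?_ ht)
    have := infDist_le_infDist_add_dist (s := M) (x := z) (y := x)
    rw [mem_closedBall] at hz
    exact ENNReal.ofReal_le_ofReal (by linarith))
  rw [dist_comm] at hyx
  refine ⟨y, hyx, le_antisymm ?_ (by linarith)⟩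
  have := infDist_le_infDist_add_dist (s := M) (x := y) (y := x)
  rw [dist_comm] at this
  linarith

open Metric in
lemma mem_cthickening_iff_infDist_le {E : Type*} [PseudoMetricSpace E]
    {M : Set E} (hne : M.Nonempty) {R : ℝ} (hR : 0 ≤ R)
    {x : E} : x ∈ cthickening R M ↔ infDist x M ≤ R := by
  rw [mem_cthickening_iff, infDist, ENNReal.le_ofReal_iff_toReal_le (infEDist_ne_top hne) hR]

open Metric in
/-- Below the reach, the boundary of a parallel set is a level set of the distance. -/
lemma mem_frontier_cthickening_iff {E : Type*} [NormedAddCommGroup E] [InnerProductSpace ℝ E] [ProperSpace E]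
    {M : Set E} (hM : IsCompact M) (hne : M.Nonempty) {R : ℝ}
    (hR : 0 < R) (hreach : ENNReal.ofReal R < reach M) {x : E} :
    x ∈ frontier (cthickening R M) ↔ infDist x M = R := by
  constructor
  · intro hx
    have := frontier_cthickening_subset M hx
    simp only [Set.mem_ofPred_eq] at this
    rw [infDist, this, ENNReal.toReal_ofReal hR.le]
  · intro hx
    rw [isClosed_cthickening.frontier_eq]
    refine ⟨(mem_cthickening_iff_infDist_le hne hR.le).2 hx.le, fun hint => ?_⟩
    obtain ⟨δ, hδ, hball⟩ := Metric.isOpen_iff.1 isOpen_interior x hint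
    obtain ⟨r, hRr, hr⟩ := ENNReal.lt_iff_exists_real_btwn.1 hreach |>.imp fun r h => h.2
    have hRr' : R < r := by
      rwa [ENNReal.ofReal_lt_ofReal_iff_of_nonneg hR.le] at hRr
    -- A level above `R`, still below the reach, and attained within `δ / 2` of `x`: it leaves the
    -- parallel set inside the ball.
    set t := min r (R + δ / 2) with htdef
    have htR : R < t := lt_min hRr' (by linarith)
    obtain ⟨y, hy, hyt⟩ := exists_dist_le_infDist_eq hM (hx ▸ hR) (hx ▸ htR.le)
      ((ENNReal.ofReal_le_ofReal (min_le_left _ _)).trans_lt hr)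
    have hle : t ≤ R + δ / 2 := min_le_right _ _
    have hyb : y ∈ ball x δ := by
      rw [mem_ball, dist_comm]; linarith
    have := (mem_cthickening_iff_infDist_le hne hR.le).1 (interior_subset (hball hyb))
    linarith

open Metric in
/-- The distance from a point of a parallel set to the boundary of that set. -/
lemma infDist_frontier_cthickening {E : Type*} [NormedAddCommGroup E] [InnerProductSpace ℝ E] [ProperSpace E]
    {M : Set E} (hM : IsCompact M) (hne : M.Nonempty)
    (hint : interior M = ∅) {R : ℝ} (hR : 0 < R) (hreach : ENNReal.ofReal R < reach M) {y : E}
    (hy : infDist y M ≤ R) :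
    (frontier (cthickening R M)).Nonempty ∧
      infDist y (frontier (cthickening R M)) = R - infDist y M := by
  have hfr := fun x => mem_frontier_cthickening_iff (x := x) hM hne hR hreach
  have hlower : ∀ z ∈ frontier (cthickening R M), R - infDist y M ≤ dist y z := by
    intro z hz
    have := infDist_le_infDist_add_dist (s := M) (x := z) (y := y)
    rw [(hfr z).1 hz, dist_comm] at this
    linarith
  have hupper : ∀ ε > 0, ∃ z ∈ frontier (cthickening R M), dist y z ≤ R - infDist y M + ε := by
    intro ε hε
    -- The growth lemma needs a positive distance. A point of `M` is first moved slightly off `M`,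
    -- which is possible since the interior is empty.
    obtain ⟨x, hxy, hx0⟩ : ∃ x, dist y x < min (ε / 2) R ∧
        (0 < infDist x M ∧ infDist x M ≤ R) := by
      rcases (infDist_nonneg (x := y) (s := M)).eq_or_lt with h0 | h0
      · have hyM : y ∈ M := (hM.isClosed.mem_iff_infDist_zero hne).2 h0.symm
        have hd := interior_eq_empty_iff_dense_compl.1 hint
        obtain ⟨x, hxM, hx⟩ := hd.exists_dist_lt y (lt_min (half_pos hε) hR)
        refine ⟨x, hx, (hM.isClosed.notMem_iff_infDist_pos hne).1 hxM, ?_⟩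
        have := infDist_le_dist_of_mem (x := x) hyM
        rw [dist_comm] at this
        exact this.trans (hx.le.trans (min_le_right _ _))
      · exact ⟨y, by rw [dist_self]; exact lt_min (half_pos hε) hR, h0, hy⟩
    obtain ⟨z, hz, hzR⟩ := exists_dist_le_infDist_eq hM hx0.1 hx0.2 hreach
    refine ⟨z, (hfr z).2 hzR, ?_⟩
    have h1 := dist_triangle y x z
    have h2 := infDist_le_infDist_add_dist (s := M) (x := y) (y := x)
    have h3 := hxy.trans_le (min_le_left _ _)
    linarith
  obtain ⟨z, hz, -⟩ := hupper 1 one_pos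
  refine ⟨⟨z, hz⟩, le_antisymm (le_of_forall_pos_le_add fun ε hε => ?_)
    ((le_infDist ⟨z, hz⟩).2 fun w hw => hlower w hw)⟩
  obtain ⟨z, hz, hle⟩ := hupper ε hε
  exact (infDist_le_dist_of_mem hz).trans hle

/-! ### Denoised points -/

/-- If `y` lies almost on a segment from `p` to `m` of length almost `R`, then the point at distance
`R` from `p` in the direction of `y` is close to `m`. -/
lemma norm_add_smul_sub_sq_le {E : Type*} [NormedAddCommGroup E] [InnerProductSpace ℝ E]
    {p y m : E} {R a D₀ : ℝ} (ha : 0 ≤ a) (haR : a ≤ R) (hD₀ : 0 < D₀)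
    (hD : D₀ ≤ ‖y - p‖) (hs : ‖y - m‖ ≤ R) (hm : R - a ≤ ‖m - p‖)
    (hle : ‖y - p‖ + ‖y - m‖ ≤ R + a) :
    ‖p + (R / ‖y - p‖) • (y - p) - m‖ ^ 2 ≤ 3 * R * a * (1 + 2 * R / D₀) := by
  have hR : 0 ≤ R := ha.trans haR
  set v := y - p with hv
  set w := m - p with hw
  have hym : y - m = v - w := by rw [hv, hw]; abel
  have hzm : p + (R / ‖v‖) • v - m = (R / ‖v‖) • v - w := by rw [hw]; abel
  rw [hzm]
  rw [hym] at hs hle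
  set D := ‖v‖
  set s := ‖v - w‖
  have hD0 : 0 < D := hD₀.trans_le hD
  have hs0 : 0 ≤ s := norm_nonneg _
  have hs2 : s ^ 2 = D ^ 2 - 2 * inner ℝ v w + ‖w‖ ^ 2 := norm_sub_sq_real v w
  have hwle : ‖w‖ ≤ R + a := by
    have := norm_sub_le v (v - w)
    rw [sub_sub_cancel] at this
    linarith
  have hlow : R - a ≤ D + s := by
    have := norm_sub_le v (v - w)
    rw [sub_sub_cancel] at this
    linarith
  -- Eliminating the inner product through `hs2` leaves two differences of squares, each of order `R
  -- * a`.
  have hkey : ‖(R / D) • v - w‖ ^ 2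
      = (‖w‖ ^ 2 - R ^ 2) * (1 - R / D) + (R / D) * (s ^ 2 - (R - D) ^ 2) := by
    rw [norm_sub_sq_real, inner_smul_left, norm_smul, Real.norm_eq_abs,
      abs_of_nonneg (div_nonneg hR hD0.le), hs2]
    simp only [conj_trivial]
    change (R / D * D) ^ 2 - _ + _ = _
    field_simp
    ring
  rw [hkey]
  have h1 : |‖w‖ ^ 2 - R ^ 2| ≤ 3 * R * a := by
    rw [abs_le]
    constructor <;> nlinarith [norm_nonneg w]
  have hq : 0 ≤ R / D := div_nonneg hR hD0.le
  have h2 : |1 - R / D| ≤ 1 + R / D := by rw [abs_le]; constructor <;> linarith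
  have h3 : s ^ 2 - (R - D) ^ 2 ≤ 3 * R * a := by
    have e1 : s - (R - D) ≤ a := by linarith
    have e2 : -a ≤ s - (R - D) := by linarith
    rcases le_total 0 (s + (R - D)) with h | h <;> nlinarith
  have h4 : (‖w‖ ^ 2 - R ^ 2) * (1 - R / D) ≤ 3 * R * a * (1 + R / D) := by
    refine (le_abs_self _).trans ?_
    rw [abs_mul]
    exact mul_le_mul h1 h2 (abs_nonneg _) (by positivity)
  have h5 : R / D ≤ R / D₀ := div_le_div_of_nonneg_left hR hD₀ hD
  have h6 : (R / D) * (s ^ 2 - (R - D) ^ 2) ≤ (R / D) * (3 * R * a) :=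
    mul_le_mul_of_nonneg_left h3 hq
  have h7 : 0 ≤ 3 * R * a := by positivity
  have : 2 * R / D₀ = 2 * (R / D₀) := by ring
  rw [this]
  nlinarith

-- Used in both directions: to bound the distance to the estimated boundary from above, and from
-- below for the selection test.
open Metric in
lemma infDist_le_infDist_add_of_hausdorffEDist_lt {X : Type*} [PseudoMetricSpace X] {A B : Set X}
    (hB : B.Nonempty) {a : ℝ} (hAB : hausdorffEDist A B < ENNReal.ofReal a) (y : X) :
    infDist y A ≤ infDist y B + a := by
  have ha : 0 < a := by
    by_contra h
    rw [ENNReal.ofReal_of_nonpos (not_lt.1 h)] at hAB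
    exact not_lt_zero hAB
  refine le_of_forall_pos_le_add fun ε hε => ?_
  obtain ⟨b, hb, hyb⟩ := (infDist_lt_iff hB).1 (lt_add_of_pos_right (infDist y B) hε)
  rw [hausdorffEDist_comm] at hAB
  obtain ⟨x, hx, hbx⟩ := exists_edist_lt_of_hausdorffEDist_lt hb hAB
  rw [edist_dist, ENNReal.ofReal_lt_ofReal_iff ha] at hbx
  have h1 := infDist_le_dist_of_mem (x := y) hx
  have h2 := dist_triangle y b x
  linarith

open Metric in
/-- A denoised point is close to the projection on `M` of the point it comes from. -/
lemma exists_dist_denoised_le {E : Type*} [NormedAddCommGroup E] [InnerProductSpace ℝ E] [ProperSpace E]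
    {M : Set E} (hM : IsCompact M) (hne : M.Nonempty)
    (hint : interior M = ∅) {R : ℝ} (hR : 0 < R) (hreach : ENNReal.ofReal R < reach M)
    {A : Set E} {a e R' lam : ℝ} (haR : a ≤ R) (heR : e ≤ R / 2) (hlam : 0 < lam)
    (hA : hausdorffEDist A (frontier (cthickening R M)) < ENNReal.ofReal a)
    (hR' : |R' - R| ≤ e) {y p : E} (hy : infDist y M ≤ R) (hp : IsMetricProjection A y p)
    (hsel : lam * R' < infDist y A) :
    ∃ m ∈ M, infDist y M = dist y m ∧
      dist (p + (R' / ‖y - p‖) • (y - p)) m ≤ √(3 * (R + 4 * R / lam)) * √a + e := by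
  have ha : 0 < a := by
    by_contra h
    rw [ENNReal.ofReal_of_nonpos (not_lt.1 h)] at hA
    exact not_lt_zero hA
  obtain ⟨m, hmM, hm⟩ := hM.exists_infDist_eq_dist hne y
  refine ⟨m, hmM, hm, ?_⟩
  obtain ⟨hfne, hfd⟩ := infDist_frontier_cthickening hM hne hint hR hreach hy
  have hDle := infDist_le_infDist_add_of_hausdorffEDist_lt hfne hA y
  have hD : ‖y - p‖ = infDist y A := by rw [← dist_eq_norm, hp.2]
  have hs : ‖y - m‖ = infDist y M := by rw [← dist_eq_norm, hm]
  obtain ⟨q, hq, hpq⟩ := exists_edist_lt_of_hausdorffEDist_lt hp.1 hA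
  rw [edist_dist, ENNReal.ofReal_lt_ofReal_iff ha] at hpq
  have hqM : R ≤ dist q m := by
    rw [← (mem_frontier_cthickening_iff hM hne hR hreach).1 hq]
    exact infDist_le_dist_of_mem hmM
  have hmp : R - a ≤ ‖m - p‖ := by
    rw [← dist_eq_norm, dist_comm]
    have := dist_triangle q p m
    rw [dist_comm q p] at this
    linarith
  have hR'2 : R / 2 ≤ R' := by
    have := (abs_le.1 hR').1
    linarith
  have hDD : lam * R / 2 ≤ ‖y - p‖ := by rw [hD]; nlinarith
  have hD0 : 0 < lam * R / 2 := by positivity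
  have h1 := norm_add_smul_sub_sq_le ha.le haR hD0 hDD (hs.trans_le hy) hmp (by linarith)
  -- With `D₀ = lam * R / 2` the factor `1 + 2 * R / D₀` equals `1 + 4 / lam`.
  have h2 : ‖p + (R / ‖y - p‖) • (y - p) - m‖ ≤ √(3 * (R + 4 * R / lam)) * √a := by
    rw [← Real.sqrt_mul (by positivity)]
    refine Real.le_sqrt_of_sq_le (h1.trans_eq ?_)
    field_simp
    ring
  have hD1 : 0 < ‖y - p‖ := hD0.trans_le hDD
  -- Replacing `R` by `R'` slides the point along the ray by exactly `|R' - R|`.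
  have h3 : p + (R' / ‖y - p‖) • (y - p) - m
      = (p + (R / ‖y - p‖) • (y - p) - m) + ((R' - R) / ‖y - p‖) • (y - p) := by
    rw [sub_div, sub_smul]; abel
  have h4 : ‖((R' - R) / ‖y - p‖) • (y - p)‖ = |R' - R| := by
    rw [norm_smul, Real.norm_eq_abs, abs_div, abs_norm, div_mul_cancel₀ _ hD1.ne']
  rw [dist_eq_norm, h3]
  refine (norm_add_le _ _).trans ?_
  rw [h4]
  linarith

open Metric in
/-- The denoised sample is close to `M` as soon as the sample is dense near `M`. -/
lemma hausdorffEDist_denoisedSample_le {E : Type*} [NormedAddCommGroup E] [InnerProductSpace ℝ E] [ProperSpace E]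
    {M : Set E} (hM : IsCompact M) (hne : M.Nonempty)
    (hint : interior M = ∅) {R : ℝ} (hR : 0 < R) (hreach : ENNReal.ofReal R < reach M)
    {A : Set E} {a e ε R' lam : ℝ} (haR : a ≤ R) (heR : e ≤ R / 2) (hlam : 0 < lam)
    (hsmall : lam * (R + e) < R - ε - a)
    (hA : hausdorffEDist A (frontier (cthickening R M)) < ENNReal.ofReal a)
    (hR' : |R' - R| ≤ e) {n : ℕ} {y : Fin n → E} {p : E → E} (hy : ∀ i, infDist (y i) M ≤ R)
    (hp : A.Nonempty → ∀ i, IsMetricProjection A (y i) (p (y i)))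
    (hcov : ∀ x ∈ M, ∃ i, dist (y i) x < ε) :
    hausdorffEDist (denoisedSample A R' lam p y) M ≤
      ENNReal.ofReal (√(3 * (R + 4 * R / lam)) * √a + e + 2 * ε) := by
  have hAne : A.Nonempty := by
    obtain ⟨x, hx⟩ := hne
    have hfne := (infDist_frontier_cthickening hM ⟨x, hx⟩ hint hR hreach
      (y := x) (by rw [infDist_zero_of_mem hx]; exact hR.le)).1
    obtain ⟨z, hz⟩ := hfne
    rw [hausdorffEDist_comm] at hA
    obtain ⟨w, hw, -⟩ := exists_edist_lt_of_hausdorffEDist_lt hz hA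
    exact ⟨w, hw⟩
  have hε : 0 < ε := by
    obtain ⟨x, hx⟩ := hne
    obtain ⟨i, hi⟩ := hcov x hx
    exact dist_nonneg.trans_lt hi
  refine hausdorffEDist_le_of_mem_edist ?_ ?_
  · rintro z ⟨i, hsel, rfl⟩
    obtain ⟨m, hm, -, hd⟩ := exists_dist_denoised_le hM hne hint hR hreach haR heR hlam hA hR'
      (hy i) (hp hAne i) hsel
    refine ⟨m, hm, ?_⟩
    rw [edist_dist]
    exact ENNReal.ofReal_le_ofReal (by linarith)
  · intro x hx
    obtain ⟨i, hi⟩ := hcov x hx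
    have hyx : infDist (y i) M < ε := (infDist_le_dist_of_mem hx).trans_lt hi
    obtain ⟨hfne, hfd⟩ := infDist_frontier_cthickening hM hne hint hR hreach (hy i)
    have hsel : lam * R' < infDist (y i) A := by
      rw [hausdorffEDist_comm] at hA
      have h1 := infDist_le_infDist_add_of_hausdorffEDist_lt hAne hA (y i)
      have h2 := (abs_le.1 hR').2
      have h3 : lam * R' ≤ lam * (R + e) := mul_le_mul_of_nonneg_left (by linarith) hlam.le
      linarith
    obtain ⟨m, hm, hym, hd⟩ := exists_dist_denoised_le hM hne hint hR hreach haR heR hlam hA hR'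
      (hy i) (hp hAne i) hsel
    refine ⟨_, ⟨i, hsel, rfl⟩, ?_⟩
    rw [edist_dist, dist_comm]
    refine ENNReal.ofReal_le_ofReal ?_
    -- Both `dist m (y i)` and `dist (y i) x` are below `ε`, hence the term `2 * ε`.
    have h1 := dist_triangle (p (y i) + (R' / ‖y i - p (y i)‖) • (y i - p (y i))) m x
    have h2 := dist_triangle m (y i) x
    rw [dist_comm m (y i)] at h2
    linarith

/-! ### Covering of `M` by the sample -/

/-- If the separated finite subsets of `M` have at most `N` points, then so does some net of `M`. -/
lemma exists_finset_net {X : Type*} [PseudoMetricSpace X] {M : Set X} {r : ℝ} {N : ℕ} (hr : 0 < r)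
    (h : ∀ T : Finset X, (T : Set X) ⊆ M → (T : Set X).Pairwise (fun s t => r ≤ dist s t) →
      T.card ≤ N) :
    ∃ T : Finset X, (T : Set X) ⊆ M ∧ T.card ≤ N ∧ ∀ x ∈ M, ∃ t ∈ T, dist t x < r := by
  classical
  -- A separated set of maximal cardinality is a net, since an uncovered point could be added to it.
  let Q : ℕ → Prop := fun k => ∃ T : Finset X, (T : Set X) ⊆ M ∧
    (T : Set X).Pairwise (fun s t => r ≤ dist s t) ∧ T.card = k
  have hQ0 : Q 0 := ⟨∅, by simp, by simp, rfl⟩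
  obtain ⟨T, hTM, hTs, hTc⟩ : Q (Nat.findGreatest Q N) :=
    Nat.findGreatest_spec (Nat.zero_le N) hQ0
  refine ⟨T, hTM, h T hTM hTs, fun x hx => ?_⟩
  by_contra! hcon
  have hsub : ((insert x T : Finset X) : Set X) ⊆ M := by
    rw [Finset.coe_insert]
    exact Set.insert_subset hx hTM
  have hsep : ((insert x T : Finset X) : Set X).Pairwise (fun s t => r ≤ dist s t) := by
    rw [Finset.coe_insert, Set.pairwise_insert]
    exact ⟨hTs, fun t ht _ => ⟨dist_comm t x ▸ hcon t ht, hcon t ht⟩⟩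
  have hxT : x ∉ T := by
    intro hxT
    have := hcon x hxT
    rw [dist_self] at this
    linarith
  have hcard : (insert x T).card = Nat.findGreatest Q N + 1 := by
    rw [Finset.card_insert_of_notMem hxT, hTc]
  have hle := h _ hsub hsep
  have := Nat.le_findGreatest (P := Q) hle ⟨_, hsub, hsep, rfl⟩
  omega

/-- Independence gives `(1 - P B) ^ n`, and `1 - u ≤ exp (-u)`. -/
lemma measure_forall_notMem_le {Ω X : Type*} [MeasurableSpace Ω] [MeasurableSpace X]
    {μ : Measure Ω} {P : Measure X} [IsProbabilityMeasure P] {Y : ℕ → Ω → X}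
    (hYm : ∀ i, Measurable (Y i)) (hlaw : ∀ i, μ.map (Y i) = P) (hindep : iIndepFun Y μ)
    {B : Set X} (hB : MeasurableSet B) {q : ℝ} (hq : q ≤ P.real B) (n : ℕ) :
    μ {ω | ∀ i : Fin n, Y i ω ∉ B} ≤ ENNReal.ofReal (Real.exp (-(n * q))) := by
  have h1 : {ω | ∀ i : Fin n, Y i ω ∉ B} = ⋂ i ∈ Finset.range n, Y i ⁻¹' Bᶜ := by
    ext ω
    simp only [Set.mem_ofPred_eq, Set.mem_iInter, Finset.mem_range, Set.mem_preimage,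
      Set.mem_compl_iff]
    exact ⟨fun h i hi => h ⟨i, hi⟩, fun h i => h i i.2⟩
  have h2 : ∀ i, μ (Y i ⁻¹' Bᶜ) = ENNReal.ofReal (1 - P.real B) := by
    intro i
    rw [← Measure.map_apply (hYm i) hB.compl, hlaw i, ← probReal_compl_eq_one_sub hB,
      ofReal_measureReal]
  rw [h1, hindep.measure_inter_preimage_eq_mul _ (fun _ _ => hB.compl)]
  simp only [h2, Finset.prod_const, Finset.card_range]
  have h3 : 0 ≤ 1 - P.real B := sub_nonneg.2 measureReal_le_one
  rw [← ENNReal.ofReal_pow h3]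
  refine ENNReal.ofReal_le_ofReal ?_
  have h4 : 1 - P.real B ≤ Real.exp (-q) := by
    have := Real.add_one_le_exp (-q)
    linarith
  refine (pow_le_pow_left₀ h3 h4 n).trans_eq ?_
  rw [← Real.exp_nat_mul]
  congr 1
  ring

open Metric in
/-- If the balls of radius `ρ n` centred in `M` have mass at least `3 log n / n`, then almost surely
every point of `M` is eventually within `3 ρ n` of the sample. -/
lemma ae_eventually_forall_exists_dist_lt {Ω X : Type*} [MeasurableSpace Ω]
    [PseudoMetricSpace X] [MeasurableSpace X] [OpensMeasurableSpace X]
    {μ : Measure Ω} {P : Measure X} [IsProbabilityMeasure P] {Y : ℕ → Ω → X}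
    (hYm : ∀ i, Measurable (Y i)) (hlaw : ∀ i, μ.map (Y i) = P) (hindep : iIndepFun Y μ)
    {M : Set X} {ρ : ℕ → ℝ} (hρ : ∀ᶠ n in atTop, 0 < ρ n)
    (hP : ∀ᶠ n : ℕ in atTop, ∀ x ∈ M, 3 * Real.log n / n ≤ P.real (ball x (ρ n))) :
    ∀ᵐ ω ∂μ, ∀ᶠ n : ℕ in atTop, ∀ x ∈ M, ∃ i : Fin n, dist (Y i ω) x < 3 * ρ n := by
  have hbad : ∀ᶠ n : ℕ in atTop,
      μ {ω | ¬ ∀ x ∈ M, ∃ i : Fin n, dist (Y i ω) x < 3 * ρ n} ≤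
        ENNReal.ofReal (1 / (n : ℝ) ^ 2) := by
    filter_upwards [hρ, hP, eventually_ge_atTop 3] with n hρn hPn hn3
    have hn3' : (3 : ℝ) ≤ n := by exact_mod_cast hn3
    have hn0 : (0 : ℝ) < n := by linarith
    have hlog : 1 ≤ 3 * Real.log n := by
      have h1 : Real.log 2 ≤ Real.log n := Real.log_le_log (by norm_num) (by linarith)
      have := Real.log_two_gt_d9
      linarith
    have hPpos : ∀ x ∈ M, 1 / (n : ℝ) ≤ P.real (ball x (ρ n)) := fun x hx =>
      (div_le_div_of_nonneg_right hlog hn0.le).trans (hPn x hx)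
    -- Balls of radius `ρ n` around `2 * ρ n`-separated points are disjoint and of mass at least `1
    -- / n`, so there are at most `n` of them. Each is missed with probability at most `n⁻³`, which
    -- yields the summable bound `n⁻²`.
    obtain ⟨T, hTM, hTc, hTnet⟩ := exists_finset_net (M := M) (r := 2 * ρ n) (N := n)
      (by linarith) (by
        intro T hTM hTs
        have hdisj : Set.PairwiseDisjoint (T : Set X) (fun t => ball t (ρ n)) := by
          intro s hs t ht hst
          exact ball_disjoint_ball (by have := hTs hs ht hst; linarith)
        have h1 := measureReal_biUnion_finset (μ := P) hdisj (fun t _ => measurableSet_ball)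
        have h2 : (T.card : ℝ) * (1 / n) ≤ ∑ t ∈ T, P.real (ball t (ρ n)) := by
          rw [← nsmul_eq_mul]
          exact Finset.card_nsmul_le_sum _ _ _ fun t ht => hPpos t (hTM ht)
        have h3 : (T.card : ℝ) * (1 / n) ≤ 1 := by
          rw [← h1] at h2
          exact h2.trans measureReal_le_one
        rw [mul_one_div, div_le_one hn0] at h3
        exact_mod_cast h3)
    have hsub : {ω | ¬ ∀ x ∈ M, ∃ i : Fin n, dist (Y i ω) x < 3 * ρ n} ⊆
        ⋃ t ∈ T, {ω | ∀ i : Fin n, Y i ω ∉ ball t (ρ n)} := by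
      intro ω hω
      simp only [Set.mem_ofPred_eq, not_forall, not_exists, not_lt] at hω
      obtain ⟨x, hx, hfar⟩ := hω
      obtain ⟨t, ht, htx⟩ := hTnet x hx
      refine Set.mem_biUnion ht fun i hi => ?_
      have h1 := hfar i
      have h2 := dist_triangle (Y i ω) t x
      rw [mem_ball] at hi
      linarith
    have hexp : Real.exp (-(n * (3 * Real.log n / n))) = 1 / (n : ℝ) ^ 3 := by
      rw [mul_div_cancel₀ _ hn0.ne', Real.exp_neg, mul_comm, Real.exp_mul, Real.exp_log hn0,
        one_div]
      norm_cast
    calc μ {ω | ¬ ∀ x ∈ M, ∃ i : Fin n, dist (Y i ω) x < 3 * ρ n}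
        ≤ ∑ t ∈ T, μ {ω | ∀ i : Fin n, Y i ω ∉ ball t (ρ n)} :=
          (measure_mono hsub).trans (measure_biUnion_finset_le _ _)
      _ ≤ ∑ t ∈ T, ENNReal.ofReal (1 / (n : ℝ) ^ 3) := Finset.sum_le_sum fun t ht => by
          rw [← hexp]
          exact measure_forall_notMem_le hYm hlaw hindep measurableSet_ball (hPn t (hTM ht)) n
      _ = ENNReal.ofReal (T.card * (1 / (n : ℝ) ^ 3)) := by
          rw [Finset.sum_const, nsmul_eq_mul, ENNReal.ofReal_mul (Nat.cast_nonneg _),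
            ENNReal.ofReal_natCast]
      _ ≤ ENNReal.ofReal (1 / (n : ℝ) ^ 2) := by
          refine ENNReal.ofReal_le_ofReal ?_
          have : (T.card : ℝ) ≤ n := by exact_mod_cast hTc
          calc (T.card : ℝ) * (1 / (n : ℝ) ^ 3) ≤ n * (1 / (n : ℝ) ^ 3) := by gcongr
            _ = 1 / (n : ℝ) ^ 2 := by field_simp
  obtain ⟨N, hN⟩ := eventually_atTop.1 hbad
  have hsum : ∑' k : ℕ, μ {ω | ¬ ∀ x ∈ M, ∃ i : Fin (k + N), dist (Y i ω) x < 3 * ρ (k + N)}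
      ≠ ∞ := by
    have hs : Summable fun k : ℕ => 1 / ((k + N : ℕ) : ℝ) ^ 2 :=
      (summable_nat_add_iff N).2 (Real.summable_one_div_nat_pow.2 one_lt_two)
    exact ne_top_of_le_ne_top hs.tsum_ofReal_ne_top
      (ENNReal.tsum_le_tsum fun k => hN (k + N) (Nat.le_add_left N k))
  have hBC := measure_setOfPred_frequently_eq_zero hsum
  filter_upwards [measure_eq_zero_iff_ae_notMem.1 hBC] with ω hω
  simp only [not_frequently, not_not] at hω
  obtain ⟨K, hK⟩ := eventually_atTop.1 hω
  filter_upwards [eventually_ge_atTop (K + N)] with n hn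
  obtain ⟨k, rfl⟩ : ∃ k, n = k + N := ⟨n - N, by omega⟩
  exact hK k (by omega)

-- The absolutely continuous part of `P` alone already carries this mass.
open Metric in
lemma le_measureReal_ball_of_le_rnDeriv {F : Type*} [NormedAddCommGroup F] [NormedSpace ℝ F]
    [FiniteDimensional ℝ F] [MeasurableSpace F] [BorelSpace F] (ν : Measure F)
    [ν.IsAddHaarMeasure] {P : Measure F} [IsFiniteMeasure P] {S : Set F} {f₀ : ℝ}
    (hf₀ : 0 ≤ f₀) (hdens : ∀ᵐ x ∂(ν.restrict S), ENNReal.ofReal f₀ ≤ P.rnDeriv ν x)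
    {x : F} {r : ℝ} (hr : 0 < r) (hS : ball x r ⊆ S) :
    f₀ * (r ^ Module.finrank ℝ F * ν.real (closedBall 0 1)) ≤ P.real (ball x r) := by
  have hvol : ν (ball x r) =
      ENNReal.ofReal (r ^ Module.finrank ℝ F * ν.real (closedBall 0 1)) := by
    rw [Measure.addHaar_ball_of_pos ν x hr, ← Measure.addHaar_unitClosedBall_eq_addHaar_unitBall,
      ENNReal.ofReal_mul (by positivity), ofReal_measureReal measure_closedBall_lt_top.ne]
  have h1 : ENNReal.ofReal f₀ * ν (ball x r) ≤ P (ball x r) := by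
    refine le_trans ?_ (Measure.setLIntegral_rnDeriv_le (ν := ν) (ball x r))
    rw [← setLIntegral_const]
    exact lintegral_mono_ae (ae_restrict_of_ae_restrict_of_subset hS hdens)
  rw [hvol, ← ENNReal.ofReal_mul hf₀] at h1
  exact (ENNReal.ofReal_le_iff_le_toReal (measure_ne_top _ _)).1 h1

end Denoising

/-! ### Main theorem -/

theorem theorem5 {Ω : Type*} [MeasurableSpace Ω] (μ : Measure Ω) [IsProbabilityMeasure μ]
    (d : ℕ) (hd : 0 < d)
    -- the geometric model
    (M : Set (EuclideanSpace ℝ (Fin d))) (hM : IsCompact M) (hMint : interior M = ∅)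
    (R₁ : ℝ) (hR₁ : 0 < R₁) (hreach : ENNReal.ofReal R₁ < Denoising.reach M)
    -- the common law of the observations
    (P : Measure (EuclideanSpace ℝ (Fin d))) [IsProbabilityMeasure P]
    (hsupp : P.support = Metric.cthickening R₁ M)
    (hac : P ≪ volume)
    (f₀ : ℝ) (hf₀ : 0 < f₀)
    (hdens : ∀ᵐ x ∂(volume.restrict (Metric.cthickening R₁ M)),
      ENNReal.ofReal f₀ ≤ P.rnDeriv volume x)
    -- the iid sample
    (Y : ℕ → Ω → EuclideanSpace ℝ (Fin d)) (hYm : ∀ i, Measurable (Y i))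
    (hlaw : ∀ i, μ.map (Y i) = P) (hindep : iIndepFun Y μ)
    -- the estimators of the support and of the noise level, with their rates
    (Shat : ∀ n : ℕ, (Fin n → EuclideanSpace ℝ (Fin d)) → Set (EuclideanSpace ℝ (Fin d)))
    (Rhat : ∀ n : ℕ, (Fin n → EuclideanSpace ℝ (Fin d)) → ℝ)
    (a e : ℕ → ℝ) (ha : Tendsto a atTop (𝓝 0)) (he : Tendsto e atTop (𝓝 0))
    (hShat : ∀ᵐ ω ∂μ, ∀ᶠ n : ℕ in atTop,
      Metric.hausdorffEDist (frontier (Shat n fun i => Y i ω))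
        (frontier (Metric.cthickening R₁ M)) < ENNReal.ofReal (a n))
    (hRhat : ∀ᵐ ω ∂μ, ∀ᶠ n : ℕ in atTop, |Rhat n (fun i => Y i ω) - R₁| ≤ e n)
    -- the choice of the metric projections on the estimated boundary
    (proj : ∀ n : ℕ, (Fin n → EuclideanSpace ℝ (Fin d)) →
      EuclideanSpace ℝ (Fin d) → EuclideanSpace ℝ (Fin d))
    (hproj : ∀ (n : ℕ) (y : Fin n → EuclideanSpace ℝ (Fin d)),
      (frontier (Shat n y)).Nonempty →
        ∀ i, Denoising.IsMetricProjection (frontier (Shat n y)) (y i) (proj n y (y i)))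
    -- the parameters `lam` and `c`
    (lam : ℝ) (hlam : lam ∈ Set.Ioo (0 : ℝ) 1)
    (c : ℝ)
    (hc : (6 / (f₀ * volume.real
      (Metric.closedBall (0 : EuclideanSpace ℝ (Fin d)) 1))) ^ ((1 : ℝ) / d) < c) :
    ∃ b : ℕ → ℝ,
      b =O[atTop] (fun n : ℕ =>
        max (max (a n ^ ((1 : ℝ) / 3)) (e n)) (c * (Real.log n / n) ^ ((1 : ℝ) / d))) ∧
      ∀ᵐ ω ∂μ, ∀ᶠ n : ℕ in atTop,
        Metric.hausdorffEDist
          (Denoising.denoisedSample (frontier (Shat n fun i => Y i ω))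
            (Rhat n fun i => Y i ω) lam (proj n fun i => Y i ω) (fun i : Fin n => Y i ω))
          M ≤ ENNReal.ofReal (b n) := by
  have hV : 0 < volume.real (Metric.closedBall (0 : EuclideanSpace ℝ (Fin d)) 1) :=
    ENNReal.toReal_pos (Metric.measure_closedBall_pos _ _ one_pos).ne'
      measure_closedBall_lt_top.ne
  set V := volume.real (Metric.closedBall (0 : EuclideanSpace ℝ (Fin d)) 1)
  have hc0 : 0 < c := lt_of_le_of_lt (by positivity) hc
  have hne : M.Nonempty := by
    by_contra h
    rw [Set.not_nonempty_iff_eq_empty.1 h, Metric.cthickening_empty,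
      Measure.support_eq_empty_iff] at hsupp
    exact IsProbabilityMeasure.ne_zero P hsupp
  -- Chosen so that `f₀ * V * (K * δ n) ^ d = 3 * log n / n`.
  set K : ℝ := (3 / (f₀ * V)) ^ ((1 : ℝ) / d)
  have hK : 0 < K := by positivity
  set δ : ℕ → ℝ := fun n => (Real.log n / n) ^ ((1 : ℝ) / d)
  have hlog : Tendsto (fun n : ℕ => Real.log n / n) atTop (𝓝 0) := by
    have := Real.isLittleO_log_id_atTop.tendsto_div_nhds_zero
    exact this.comp tendsto_natCast_atTop_atTop
  have hδ : Tendsto δ atTop (𝓝 0) := by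
    have hd' : (0 : ℝ) < (1 : ℝ) / d := by positivity
    have := hlog.rpow_const (p := (1 : ℝ) / d) (Or.inr hd'.le)
    rwa [Real.zero_rpow hd'.ne'] at this
  have hlogpos : ∀ᶠ n : ℕ in atTop, 0 < Real.log n / n := by
    filter_upwards [eventually_ge_atTop 2] with n hn
    have hn' : (2 : ℝ) ≤ n := by exact_mod_cast hn
    exact div_pos (Real.log_pos (by linarith)) (by linarith)
  have hδpos : ∀ᶠ n in atTop, 0 < δ n := hlogpos.mono fun n hn => Real.rpow_pos_of_pos hn _
  have hKδ : Tendsto (fun n => K * δ n) atTop (𝓝 0) := by simpa using hδ.const_mul K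
  have hmass : ∀ᶠ n : ℕ in atTop, ∀ x ∈ M,
      3 * Real.log n / n ≤ P.real (Metric.ball x (K * δ n)) := by
    filter_upwards [hlogpos, hδpos, hKδ.eventually_le_const hR₁] with n hn hδn hle x hx
    refine le_trans (le_of_eq ?_) (Denoising.le_measureReal_ball_of_le_rnDeriv volume hf₀.le hdens
      (mul_pos hK hδn) ?_)
    · have hroot : ∀ u : ℝ, 0 ≤ u → (u ^ ((1 : ℝ) / d)) ^ d = u := fun u hu => by
        rw [one_div, Real.rpow_inv_natCast_pow hu hd.ne']
      rw [finrank_euclideanSpace_fin, mul_pow, hroot _ (by positivity), hroot _ hn.le]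
      change _ = f₀ * (3 / (f₀ * V) * (Real.log n / n) * V)
      field_simp
    · intro z hz
      exact Metric.mem_cthickening_of_dist_le z x _ _ hx ((Metric.mem_ball.1 hz).le.trans hle)
  have hcov := Denoising.ae_eventually_forall_exists_dist_lt hYm hlaw hindep
    (hδpos.mono fun n hn => mul_pos hK hn) hmass
  have hYS : ∀ᵐ ω ∂μ, ∀ i, Metric.infDist (Y i ω) M ≤ R₁ := by
    refine ae_all_iff.2 fun i => ?_
    have h1 : ∀ᵐ x ∂(μ.map (Y i)), x ∈ P.support := by
      rw [hlaw i]
      exact Measure.support_mem_ae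
    filter_upwards [ae_of_ae_map (hYm i).aemeasurable h1] with ω hω
    rw [hsupp] at hω
    exact (Denoising.mem_cthickening_iff_infDist_le hne hR₁.le).1 hω
  -- The rates are deterministic, so a single good outcome gives their eventual signs.
  obtain ⟨ω₀, hω₀S, hω₀R⟩ := (hShat.and hRhat).exists
  have hapos : ∀ᶠ n in atTop, 0 < a n := by
    filter_upwards [hω₀S] with n hn
    exact ENNReal.ofReal_pos.1 (pos_of_gt hn)
  have hepos : ∀ᶠ n in atTop, 0 ≤ e n := by
    filter_upwards [hω₀R] with n hn
    exact (abs_nonneg _).trans hn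
  set C : ℝ := √(3 * (R₁ + 4 * R₁ / lam))
  refine ⟨fun n => C * √(a n) + e n + 2 * (3 * (K * δ n)), ?_, ?_⟩
  · refine Asymptotics.IsBigO.of_bound (C + 1 + 6 * K / c) ?_
    filter_upwards [hapos, hepos, hδpos, ha.eventually_le_const one_pos] with n han hen hδn ha1
    set m := max (max (a n ^ ((1 : ℝ) / 3)) (e n)) (c * (Real.log n / n) ^ ((1 : ℝ) / d))
    have h1 : √(a n) ≤ m := by
      rw [Real.sqrt_eq_rpow]
      exact (Real.rpow_le_rpow_of_exponent_ge han ha1 (by norm_num)).trans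
        ((le_max_left _ _).trans (le_max_left _ _))
    have h2 : e n ≤ m := (le_max_right _ _).trans (le_max_left _ _)
    have h3 : c * δ n ≤ m := le_max_right _ _
    have hC : 0 ≤ C := Real.sqrt_nonneg _
    have h4 : C * √(a n) ≤ C * m := mul_le_mul_of_nonneg_left h1 hC
    have h5 : 2 * (3 * (K * δ n)) ≤ 6 * K / c * m := by
      calc 2 * (3 * (K * δ n)) = 6 * K / c * (c * δ n) := by field_simp; ring
        _ ≤ 6 * K / c * m := mul_le_mul_of_nonneg_left h3 (by positivity)
    rw [Real.norm_of_nonneg (by positivity), Real.norm_of_nonneg (hen.trans h2)]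
    linarith
  -- In the limit this reads `lam * R₁ < R₁`.
  · have hsmall : ∀ᶠ n in atTop, lam * (R₁ + e n) < R₁ - 3 * (K * δ n) - a n := by
      have hl : Tendsto (fun n => lam * (R₁ + e n)) atTop (𝓝 (lam * (R₁ + 0))) :=
        (tendsto_const_nhds.add he).const_mul lam
      have hr : Tendsto (fun n => R₁ - 3 * (K * δ n) - a n) atTop (𝓝 (R₁ - 3 * 0 - 0)) :=
        (tendsto_const_nhds.sub (hKδ.const_mul 3)).sub ha
      refine hl.eventually_lt hr ?_
      have := mul_lt_mul_of_pos_right hlam.2 hR₁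
      linarith
    filter_upwards [hcov, hYS, hShat, hRhat] with ω hωcov hωS hωA hωR
    filter_upwards [hωcov, hωA, hωR, hsmall, ha.eventually_le_const hR₁,
      he.eventually_le_const (half_pos hR₁)] with n h1 h2 h3 h4 h5 h6
    exact Denoising.hausdorffEDist_denoisedSample_le hM hne hMint hR₁ hreach h5 h6 hlam.1 h4 h2 h3
      (fun i => hωS i) (fun hA => hproj n _ hA) h1
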